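/- Let $g:\mathbb{R}^D\to\mathbb{R}^D$ be globally Lipschitz, and let $\varphi_t(x_0)$ denote the value at time $t$ of the solution of $dx = g(x(t))\,dt$ with $x(0)=x_0$. Let $T>0$, and let $p_t,q_t$ ($t\in[0,T]$) be differentiable probability densities on $\mathbb{R}^D$ such that $p_t$ (respectively $q_t$) is the density of $x(t)=\varphi_t(x(0))$ when $x(0)$ has density $p_0$ (respectively $q_0$). For a density $f$ let $s_f=\nabla\log f$ be its score, and let $$F(q,p)=\tfrac12\,\mathbb{E}_{q}\big[\|s_p-s_q\|^2\big]$$ be the Fisher divergence. Assume that $p_0>0$ holds $q_0$-almost everywhere and that $F(q_0,p_0)<\infty$. Then for every $t\in[0,T]$ the divergence $F(q_t,p_t)$ is finite, the expectation below is finite (its integrand is integrable), $t\mapsto F(q_t,p_t)$ is differentiable on $[0,T]$ (one-sidedly at the endpoints), and $$\frac{d}{dt}F(q_t,p_t) = -\tfrac12\,\mathbb{E}_{q_t}\big[\Delta(x)^{\top}\big(\nabla g(x)+\nabla g(x)^{\top}\big)\Delta(x)\big],\qquad \Delta = s_{p_t}-s_{q_t}.$$ Here $\nabla g$ is the Jacobian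 matrix of $g$, which exists almost everywhere because $g$ is Lipschitz. -/

import Mathlib

open MeasureTheory Set

noncomputable section

/-- The measure on `ℝ^D` with Lebesgue density `f`. -/
def densityMeasure {D : ℕ} (f : EuclideanSpace ℝ (Fin D) → ℝ) :
    Measure (EuclideanSpace ℝ (Fin D)) :=
  volume.withDensity (fun x => ENNReal.ofReal (f x))

/-- `f` is a (differentiable) probability density function on `ℝ^D`. -/
structure IsDiffProbDensity {D : ℕ} (f : EuclideanSpace ℝ (Fin D) → ℝ) : Prop where
  nonneg : ∀ x, 0 ≤ f x
  differentiable : Differentiable ℝ f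
  isProbabilityMeasure : IsProbabilityMeasure (densityMeasure f)

/-- The score `s_f = ∇ log f`. -/
def scoreFn {D : ℕ} (f : EuclideanSpace ℝ (Fin D) → ℝ) (x : EuclideanSpace ℝ (Fin D)) :
    EuclideanSpace ℝ (Fin D) :=
  gradient (fun y => Real.log (f y)) x

/-- The score difference `Δ = s_p - s_q`. -/
def scoreDiff {D : ℕ} (q p : EuclideanSpace ℝ (Fin D) → ℝ) (x : EuclideanSpace ℝ (Fin D)) :
    EuclideanSpace ℝ (Fin D) :=
  scoreFn p x - scoreFn q x

/-- The Fisher divergence `F(q, p) = 1/2 E_q[‖s_p - s_q‖²]`. -/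
def fisherDivergence {D : ℕ} (q p : EuclideanSpace ℝ (Fin D) → ℝ) : ℝ :=
  (1 / 2) * ∫ x, ‖scoreDiff q p x‖ ^ 2 ∂(densityMeasure q)

/-- `φ t x₀` is the value at time `t` of the solution of `dx = g(x) dt` with `x(0) = x₀`. -/
structure IsODEFlow {D : ℕ} (g : EuclideanSpace ℝ (Fin D) → EuclideanSpace ℝ (Fin D))
    (φ : ℝ → EuclideanSpace ℝ (Fin D) → EuclideanSpace ℝ (Fin D)) : Prop where
  initial : ∀ x, φ 0 x = x
  hasDerivAt : ∀ x t, HasDerivAt (fun s => φ s x) (g (φ t x)) t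

/-- The quadratic form `Δ(x)ᵀ (∇g(x) + ∇g(x)ᵀ) Δ(x)` with `Δ = s_p - s_q`. -/
def driftQuadForm {D : ℕ} (g : EuclideanSpace ℝ (Fin D) → EuclideanSpace ℝ (Fin D))
    (q p : EuclideanSpace ℝ (Fin D) → ℝ) (x : EuclideanSpace ℝ (Fin D)) : ℝ :=
  inner ℝ (scoreDiff q p x)
    ((fderiv ℝ g x + ContinuousLinearMap.adjoint (fderiv ℝ g x)) (scoreDiff q p x))

end

/-! Transport by a common flow multiplies both densities by the same Jacobian factor, so `log p -
log q` is constant along trajectories (`density_mul_comp_eq`). Differentiating, with ψ the time-h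
map, gives Δ_t(x) = Dψ(x)ᵀ Δ_{t+h}(ψ x) for q_t-almost every x (`scoreDiff_eq_adjoint_fderiv`): ψ is
Lipschitz, so Rademacher's theorem applies. Neither a transport equation for the densities nor a
second derivative is needed.

Changing variables writes F at time t + h as an integral against q_t. With Dψ = 1 + hB_h, the
identity Δ_t = (1 + hB_hᵀ)z for z = Δ_{t+h}(ψ x) yields ‖z‖² = ‖Δ_t‖² - 2h⟨Δ_t, B_h Δ_t⟩ +
O(h²)‖Δ_t‖².

What remains is the limit of E[⟨Δ_t, B_h Δ_t⟩]. As g is only Lipschitz, pointwise convergence of B_h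
to ∇g is not used. The displacement quotients (ψ - id)/h are uniformly Lipschitz and converge
pointwise to g, so their Jacobians converge weak-* against L¹ functions
(`tendsto_integral_lineDeriv_mul`). This suffices because the weights q_t Δ_j Δ_k are integrable. -/

/-! ### Flow of a Lipschitz field and its displacement quotients -/

namespace IsODEFlow

variable {D : ℕ} {g : EuclideanSpace ℝ (Fin D) → EuclideanSpace ℝ (Fin D)}
  {φ : ℝ → EuclideanSpace ℝ (Fin D) → EuclideanSpace ℝ (Fin D)} {K : NNReal}

/-- The time-reversed flow is the flow of `-g`. -/
theorem neg (hφ : IsODEFlow g φ) : IsODEFlow (-g) (fun t => φ (-t)) where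
  initial x := by simpa using hφ.initial x
  hasDerivAt x t := by
    have h := (hφ.hasDerivAt x (-t)).scomp t (hasDerivAt_neg t)
    rw [neg_one_smul] at h
    exact h

theorem add_apply (hφ : IsODEFlow g φ) (hg : LipschitzWith K g) (s t : ℝ)
    (x : EuclideanSpace ℝ (Fin D)) : φ (s + t) x = φ s (φ t x) := by
  have h : (fun r => φ (r + t) x) = fun r => φ r (φ t x) := by
    refine ODE_solution_unique_univ (v := fun _ => g) (s := fun _ => univ) (K := K) (t₀ := 0)
      (fun _ => hg.lipschitzOnWith) (fun r => ⟨?_, mem_univ _⟩)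
      (fun r => ⟨hφ.hasDerivAt _ r, mem_univ _⟩) ?_
    · exact (hφ.hasDerivAt x (r + t)).comp_add_const r t
    · simp [hφ.initial]
  exact congrFun h s

theorem dist_le_of_nonneg (hφ : IsODEFlow g φ) (hg : LipschitzWith K g) {t : ℝ} (ht : 0 ≤ t)
    (x y : EuclideanSpace ℝ (Fin D)) :
    dist (φ t x) (φ t y) ≤ dist x y * Real.exp (K * t) := by
  have h := dist_le_of_trajectories_ODE (v := fun _ => g) (K := K) (a := 0) (b := t)
    (f := fun s => φ s x) (g := fun s => φ s y) (δ := dist x y) (fun _ => hg)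
    (fun s _ => (hφ.hasDerivAt x s).continuousAt.continuousWithinAt)
    (fun s _ => (hφ.hasDerivAt x s).hasDerivWithinAt)
    (fun s _ => (hφ.hasDerivAt y s).continuousAt.continuousWithinAt)
    (fun s _ => (hφ.hasDerivAt y s).hasDerivWithinAt) (by simp [hφ.initial]) t ⟨ht, le_rfl⟩
  simpa using h

theorem norm_sub_le (hφ : IsODEFlow g φ) (hg : LipschitzWith K g) (t : ℝ)
    (x y : EuclideanSpace ℝ (Fin D)) :
    ‖φ t x - φ t y‖ ≤ Real.exp (K * |t|) * ‖x - y‖ := by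
  rw [← dist_eq_norm, ← dist_eq_norm, mul_comm]
  rcases le_total 0 t with ht | ht
  · simpa [abs_of_nonneg ht] using hφ.dist_le_of_nonneg hg ht x y
  · simpa [abs_of_nonpos ht] using
      hφ.neg.dist_le_of_nonneg (K := K) hg.neg (neg_nonneg.2 ht) x y

theorem lipschitzWith (hφ : IsODEFlow g φ) (hg : LipschitzWith K g) (t : ℝ) :
    LipschitzWith (Real.exp (K * |t|)).toNNReal (φ t) :=
  LipschitzWith.of_dist_le_mul fun x y => by
    rw [dist_eq_norm, dist_eq_norm, Real.coe_toNNReal _ (Real.exp_pos _).le]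
    exact hφ.norm_sub_le hg t x y

/-- The time-`t` map of the flow of a Lipschitz vector field, as a homeomorphism. -/
def homeomorph (hφ : IsODEFlow g φ) (hg : LipschitzWith K g) (t : ℝ) :
    EuclideanSpace ℝ (Fin D) ≃ₜ EuclideanSpace ℝ (Fin D) where
  toFun := φ t
  invFun := φ (-t)
  left_inv x := by rw [← hφ.add_apply hg, neg_add_cancel, hφ.initial]
  right_inv x := by rw [← hφ.add_apply hg, add_neg_cancel, hφ.initial]
  continuous_toFun := (hφ.lipschitzWith hg t).continuous
  continuous_invFun := (hφ.lipschitzWith hg (-t)).continuous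

/-- The velocity difference g(φ s x) - g(φ s y) is controlled by the Lipschitz bounds for g and φ s;
integrating it over time produces the factor |t| that the displacement quotient divides out. -/
theorem norm_sub_sub_le (hφ : IsODEFlow g φ) (hg : LipschitzWith K g) {R t : ℝ} (ht : |t| ≤ R)
    (x y : EuclideanSpace ℝ (Fin D)) :
    ‖(φ t x - x) - (φ t y - y)‖ ≤ K * Real.exp (K * R) * ‖x - y‖ * |t| := by
  have key := (convex_uIcc (0 : ℝ) t).norm_image_sub_le_of_norm_hasDerivWithin_le
    (f := fun s => φ s x - φ s y) (f' := fun s => g (φ s x) - g (φ s y))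
    (C := K * Real.exp (K * R) * ‖x - y‖)
    (fun s _ => ((hφ.hasDerivAt x s).sub (hφ.hasDerivAt y s)).hasDerivWithinAt)
    (fun s hs => ?_) left_mem_uIcc right_mem_uIcc
  · simp only [hφ.initial, sub_zero, Real.norm_eq_abs] at key
    rwa [sub_sub_sub_comm] at key
  · have hs' : |s| ≤ R := by
      refine le_trans ?_ ht
      simpa using abs_sub_left_of_mem_uIcc hs
    calc ‖g (φ s x) - g (φ s y)‖ ≤ K * ‖φ s x - φ s y‖ := hg.norm_sub_le _ _
      _ ≤ K * (Real.exp (K * |s|) * ‖x - y‖) := by gcongr; exact hφ.norm_sub_le hg s x y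
      _ ≤ K * (Real.exp (K * R) * ‖x - y‖) := by gcongr
      _ = _ := by ring

/-- The displacement quotients `t⁻¹ • (φ t - id)` are Lipschitz, uniformly for bounded `t`. -/
theorem lipschitzWith_displacement (hφ : IsODEFlow g φ) (hg : LipschitzWith K g) {R t : ℝ}
    (ht : |t| ≤ R) :
    LipschitzWith (K * Real.exp (K * R)).toNNReal (fun x => t⁻¹ • (φ t x - x)) :=
  LipschitzWith.of_dist_le_mul fun x y => by
    have hC : 0 ≤ (K : ℝ) * Real.exp (K * R) := by positivity
    rw [dist_eq_norm, dist_eq_norm, Real.coe_toNNReal _ hC, ← smul_sub, norm_smul, norm_inv,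
      Real.norm_eq_abs]
    -- At t = 0 the convention `0⁻¹ = 0` makes the quotient the zero map.
    rcases eq_or_ne t 0 with rfl | h0
    · simp; positivity
    · have : 0 < |t| := abs_pos.2 h0
      rw [inv_mul_le_iff₀ this]
      linarith [hφ.norm_sub_sub_le hg ht x y]

theorem tendsto_displacement (hφ : IsODEFlow g φ) (x : EuclideanSpace ℝ (Fin D)) :
    Filter.Tendsto (fun t => t⁻¹ • (φ t x - x)) (nhdsWithin 0 {0}ᶜ) (nhds (g x)) := by
  have h := (hasDerivAt_iff_tendsto_slope_zero.1 (hφ.hasDerivAt x 0))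
  simpa [hφ.initial] using h

end IsODEFlow

/-! ### Weak-* convergence of derivatives -/

section WeakStar

open Filter Topology
open scoped ENNReal ContDiff

variable {E : Type*} [NormedAddCommGroup E] [NormedSpace ℝ E] [FiniteDimensional ℝ E]
  [MeasurableSpace E] [BorelSpace E] {μ : Measure E} [μ.IsAddHaarMeasure]
  {ι : Type*} {l : Filter ι} [l.IsCountablyGenerated] {f : ι → E → ℝ} {f₀ : E → ℝ} {C : NNReal}

/-- Integration by parts moves the derivative onto w, after which pointwise convergence of f and
dominated convergence are enough. -/
theorem tendsto_integral_lineDeriv_mul_of_contDiff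
    (hf : ∀ᶠ i in l, LipschitzWith C (f i)) (hf₀ : LipschitzWith C f₀)
    (hlim : ∀ x, Tendsto (fun i => f i x) l (𝓝 (f₀ x)))
    {w : E → ℝ} (hwc : HasCompactSupport w) (hw : ContDiff ℝ ∞ w) (v : E) :
    Tendsto (fun i => ∫ x, lineDeriv ℝ (f i) x v * w x ∂μ) l
      (𝓝 (∫ x, lineDeriv ℝ f₀ x v * w x ∂μ)) := by
  obtain ⟨W, hW⟩ := hw.lipschitzWith_of_hasCompactSupport hwc (by simp)
  have hd : (fun x => lineDeriv ℝ w x (-v)) = fun x => fderiv ℝ w x (-v) := by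
    ext x
    exact (hw.differentiable (by simp) x).lineDeriv_eq_fderiv
  have hdc : Continuous fun x => fderiv ℝ w x (-v) :=
    (hw.continuous_fderiv (by simp)).clm_apply continuous_const
  have hds : HasCompactSupport fun x => fderiv ℝ w x (-v) :=
    (hwc.fderiv ℝ).comp_left (g := fun L : E →L[ℝ] ℝ => L (-v)) (by simp)
  rw [hf₀.integral_lineDeriv_mul_eq hW hwc v]
  refine Tendsto.congr' (hf.mono fun i hi => (hi.integral_lineDeriv_mul_eq hW hwc v).symm) ?_
  simp only [funext_iff] at hd
  simp only [hd]
  refine tendsto_integral_filter_of_dominated_convergence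
    (fun x => ‖fderiv ℝ w x (-v)‖ * (|f₀ 0| + 1 + C * ‖x‖)) ?_ ?_ ?_ ?_
  · filter_upwards [hf] with i hi
    exact (hdc.mul hi.continuous).aestronglyMeasurable
  -- Convergence at the origin and the common Lipschitz constant give a linear growth bound uniform
  -- in i.
  · have h0 : ∀ᶠ i in l, |f i 0| < |f₀ 0| + 1 :=
      ((hlim 0).abs).eventually (gt_mem_nhds (lt_add_one _))
    filter_upwards [hf, h0] with i hi h0i
    refine Eventually.of_forall fun x => ?_
    rw [norm_mul]
    gcongr
    have h1 := hi.norm_sub_le x 0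
    rw [sub_zero] at h1
    have h2 : ‖f i x‖ ≤ ‖f i x - f i 0‖ + ‖f i 0‖ := by
      simpa using norm_add_le (f i x - f i 0) (f i 0)
    rw [Real.norm_eq_abs (f i 0)] at h2
    linarith
  · refine Continuous.integrable_of_hasCompactSupport (by fun_prop) ?_
    exact hds.norm.mul_right
  · exact Eventually.of_forall fun x => (hlim x).const_mul _

/-- Uniformly Lipschitz functions converging pointwise have weak-* converging line derivatives. -/
theorem tendsto_integral_lineDeriv_mul
    (hf : ∀ᶠ i in l, LipschitzWith C (f i)) (hf₀ : LipschitzWith C f₀)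
    (hlim : ∀ x, Tendsto (fun i => f i x) l (𝓝 (f₀ x)))
    {w : E → ℝ} (hw : Integrable w μ) (v : E) :
    Tendsto (fun i => ∫ x, lineDeriv ℝ (f i) x v * w x ∂μ) l
      (𝓝 (∫ x, lineDeriv ℝ f₀ x v * w x ∂μ)) := by
  have bound : ∀ {h : E → ℝ}, LipschitzWith C h → ∀ {w' : E → ℝ}, Integrable w' μ →
      dist (∫ x, lineDeriv ℝ h x v * w x ∂μ) (∫ x, lineDeriv ℝ h x v * w' x ∂μ) ≤
        C * ‖v‖ * ∫ x, ‖w x - w' x‖ ∂μ := by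
    intro h hh w' hw'
    have hi : ∀ {u : E → ℝ}, Integrable u μ →
        Integrable (fun x => lineDeriv ℝ h x v * u x) μ := fun hu =>
      hu.bdd_mul (aestronglyMeasurable_lineDeriv hh.continuous μ)
        (.of_forall fun x => norm_lineDeriv_le_of_lipschitz ℝ hh)
    rw [dist_eq_norm, ← integral_sub (hi hw) (hi hw'), ← integral_const_mul]
    refine norm_integral_le_of_norm_le ((hw.sub hw').norm.const_mul _) (.of_forall fun x => ?_)
    rw [← mul_sub, norm_mul]
    exact mul_le_mul_of_nonneg_right (norm_lineDeriv_le_of_lipschitz ℝ hh) (norm_nonneg _)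
  rw [Metric.tendsto_nhds]
  intro ε hε
  -- One third of ε for each replacement of w by w', one for the limit at w'; the + 1 keeps the
  -- denominator positive.
  set δ := ε / 3 / (C * ‖v‖ + 1) with hδ
  have hpos : 0 < C * ‖v‖ + 1 := by positivity
  obtain ⟨w', hw'c, hw's, hw'δ⟩ :=
    (memLp_one_iff_integrable.2 hw).exist_eLpNorm_sub_le ENNReal.one_ne_top le_rfl
      (show 0 < δ by positivity)
  have hw'i : Integrable w' μ := hw's.continuous.integrable_of_hasCompactSupport hw'c
  have hsmall : C * ‖v‖ * ∫ x, ‖w x - w' x‖ ∂μ < ε / 3 := by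
    have h1 : ∫ x, ‖w x - w' x‖ ∂μ ≤ δ := by
      have h0 : ∫ x, ‖w x - w' x‖ ∂μ = ∫ x, ‖(w - w') x‖ ∂μ := rfl
      rw [h0, integral_norm_eq_lintegral_enorm (hw.sub hw'i).aestronglyMeasurable]
      rw [eLpNorm_one_eq_lintegral_enorm] at hw'δ
      exact ENNReal.toReal_le_of_le_ofReal (by positivity) hw'δ
    calc C * ‖v‖ * ∫ x, ‖w x - w' x‖ ∂μ ≤ C * ‖v‖ * δ := by gcongr
      _ < (C * ‖v‖ + 1) * δ := by
        have : 0 < δ := by positivity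
        nlinarith
      _ = ε / 3 := by rw [hδ]; field_simp
  filter_upwards [hf, (Metric.tendsto_nhds.1
    (tendsto_integral_lineDeriv_mul_of_contDiff (μ := μ) hf hf₀ hlim hw'c hw's v)) (ε / 3)
      (by positivity)] with i hi hi'
  have h1 := bound hi hw'i
  have h2 := bound hf₀ hw'i
  rw [dist_comm] at h2
  calc _ ≤ _ := dist_triangle4 _ _ _ _
    _ < ε / 3 + ε / 3 + ε / 3 := by gcongr <;> linarith
    _ = ε := by ring

end WeakStar

/-! ### Jacobian quadratic forms in mean, and the second-order expansion -/

section QuadraticForm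

open Filter Topology

variable {D : ℕ} {ρ : EuclideanSpace ℝ (Fin D) → ℝ}
  {u : EuclideanSpace ℝ (Fin D) → EuclideanSpace ℝ (Fin D)}

theorem densityMeasure_absolutelyContinuous_volume (ρ : EuclideanSpace ℝ (Fin D) → ℝ) :
    densityMeasure ρ ≪ volume :=
  withDensity_absolutelyContinuous _ _

theorem integral_densityMeasure (hρ : Measurable ρ) (h0 : ∀ x, 0 ≤ ρ x)
    (h : EuclideanSpace ℝ (Fin D) → ℝ) :
    ∫ x, h x ∂(densityMeasure ρ) = ∫ x, ρ x * h x := by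
  rw [densityMeasure, integral_withDensity_eq_integral_toReal_smul hρ.ennreal_ofReal
    (.of_forall fun _ => ENNReal.ofReal_lt_top)]
  simp [ENNReal.toReal_ofReal (h0 _)]

theorem integrable_densityMeasure_iff (hρ : Measurable ρ) (h0 : ∀ x, 0 ≤ ρ x)
    {h : EuclideanSpace ℝ (Fin D) → ℝ} :
    Integrable h (densityMeasure ρ) ↔ Integrable fun x => ρ x * h x := by
  rw [densityMeasure, integrable_withDensity_iff_integrable_smul' hρ.ennreal_ofReal
    (.of_forall fun _ => ENNReal.ofReal_lt_top)]
  simp [ENNReal.toReal_ofReal (h0 _)]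

theorem integrable_mul_coord_mul_coord (hρ : Measurable ρ) (h0 : ∀ x, 0 ≤ ρ x)
    (hu : Measurable u) (hsq : Integrable (fun x => ‖u x‖ ^ 2) (densityMeasure ρ))
    (j k : Fin D) : Integrable fun x => ρ x * (u x j * u x k) := by
  rw [← integrable_densityMeasure_iff hρ h0]
  refine hsq.mono' (by fun_prop) (.of_forall fun x => ?_)
  rw [norm_mul, sq]
  gcongr <;> exact PiLp.norm_apply_le _ _

theorem inner_apply_eq_sum (L : EuclideanSpace ℝ (Fin D) →L[ℝ] EuclideanSpace ℝ (Fin D))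
    (v : EuclideanSpace ℝ (Fin D)) :
    inner ℝ v (L v) = ∑ j, ∑ k, L (EuclideanSpace.single k 1) j * (v j * v k) := by
  have hv : v = ∑ k, v k • EuclideanSpace.single k (1 : ℝ) := by
    simpa using ((EuclideanSpace.basisFun (Fin D) ℝ).sum_repr v).symm
  have hL : ∀ j, L v j = ∑ k, v k * L (EuclideanSpace.single k 1) j := by
    intro j
    conv_lhs => rw [hv]
    simp [map_sum]
  rw [PiLp.inner_apply]
  refine Finset.sum_congr rfl fun j _ => ?_
  rw [hL]
  simp only [RCLike.inner_apply, conj_trivial, Finset.sum_mul]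
  exact Finset.sum_congr rfl fun k _ => by ring

theorem LipschitzWith.euclidean_coord {C : NNReal}
    {F : EuclideanSpace ℝ (Fin D) → EuclideanSpace ℝ (Fin D)}
    (hF : LipschitzWith C F) (j : Fin D) : LipschitzWith C fun x => F x j :=
  LipschitzWith.of_dist_le_mul fun x y => by
    rw [dist_eq_norm, dist_eq_norm]
    exact (PiLp.norm_apply_le (F x - F y) j).trans (hF.norm_sub_le x y)

/-- In coordinates the quadratic form becomes scalar line derivatives paired with the L¹ weights ρ
u_j u_k, the setting of weak-* convergence. -/
theorem integral_inner_fderiv_eq_sum (hρ : Measurable ρ) (h0 : ∀ x, 0 ≤ ρ x)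
    (hu : Measurable u) (hsq : Integrable (fun x => ‖u x‖ ^ 2) (densityMeasure ρ))
    {C : NNReal} {F : EuclideanSpace ℝ (Fin D) → EuclideanSpace ℝ (Fin D)}
    (hF : LipschitzWith C F) :
    ∫ x, inner ℝ (u x) (fderiv ℝ F x (u x)) ∂(densityMeasure ρ) =
      ∑ j, ∑ k, ∫ x, lineDeriv ℝ (fun y => F y j) x (EuclideanSpace.single k 1) *
        (ρ x * (u x j * u x k)) := by
  have hi : ∀ j k, Integrable fun x =>
      lineDeriv ℝ (fun y => F y j) x (EuclideanSpace.single k 1) * (ρ x * (u x j * u x k)) :=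
    fun j k => (integrable_mul_coord_mul_coord hρ h0 hu hsq j k).bdd_mul
      (aestronglyMeasurable_lineDeriv (hF.euclidean_coord j).continuous _)
      (.of_forall fun x => norm_lineDeriv_le_of_lipschitz ℝ (hF.euclidean_coord j))
  rw [integral_densityMeasure hρ h0]
  calc _ = ∫ x, ∑ j, ∑ k, lineDeriv ℝ (fun y => F y j) x (EuclideanSpace.single k 1) *
        (ρ x * (u x j * u x k)) := by
        refine integral_congr_ae ?_
        filter_upwards [hF.ae_differentiableAt] with x hx
        have hl : ∀ j v, lineDeriv ℝ (fun y => F y j) x v = fderiv ℝ F x v j := by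
          intro j v
          have h := ((EuclideanSpace.proj j : EuclideanSpace ℝ (Fin D) →L[ℝ] ℝ).hasFDerivAt
            (x := F x)).comp x hx.hasFDerivAt
          exact (h.hasLineDerivAt v).lineDeriv
        simp only [hl, inner_apply_eq_sum, Finset.mul_sum]
        exact Finset.sum_congr rfl fun j _ => Finset.sum_congr rfl fun k _ => by ring
    _ = _ := by
        rw [integral_finsetSum _ fun j _ => integrable_finsetSum _ fun k _ => hi j k]
        exact Finset.sum_congr rfl fun j _ => integral_finsetSum _ fun k _ => hi j k

/-- Quadratic forms of the Jacobians of uniformly Lipschitz, pointwise converging maps converge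
in mean against square-integrable vector fields. -/
theorem tendsto_integral_inner_fderiv (hρ : Measurable ρ) (h0 : ∀ x, 0 ≤ ρ x)
    (hu : Measurable u) (hsq : Integrable (fun x => ‖u x‖ ^ 2) (densityMeasure ρ))
    {ι : Type*} {l : Filter ι} [l.IsCountablyGenerated] {C : NNReal}
    {f : ι → EuclideanSpace ℝ (Fin D) → EuclideanSpace ℝ (Fin D)}
    {f₀ : EuclideanSpace ℝ (Fin D) → EuclideanSpace ℝ (Fin D)}
    (hf : ∀ᶠ i in l, LipschitzWith C (f i)) (hf₀ : LipschitzWith C f₀)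
    (hlim : ∀ x, Tendsto (fun i => f i x) l (𝓝 (f₀ x))) :
    Tendsto (fun i => ∫ x, inner ℝ (u x) (fderiv ℝ (f i) x (u x)) ∂(densityMeasure ρ)) l
      (𝓝 (∫ x, inner ℝ (u x) (fderiv ℝ f₀ x (u x)) ∂(densityMeasure ρ))) := by
  rw [integral_inner_fderiv_eq_sum hρ h0 hu hsq hf₀]
  refine Tendsto.congr' (hf.mono fun i hi =>
    (integral_inner_fderiv_eq_sum hρ h0 hu hsq hi).symm) ?_
  refine tendsto_finsetSum _ fun j _ => tendsto_finsetSum _ fun k _ => ?_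
  exact tendsto_integral_lineDeriv_mul (hf.mono fun i hi => hi.euclidean_coord j)
    (hf₀.euclidean_coord j)
    (fun x => ((EuclideanSpace.proj j : EuclideanSpace ℝ (Fin D) →L[ℝ] ℝ).continuous.tendsto
      (f₀ x)).comp (hlim x))
    (integrable_mul_coord_mul_coord hρ h0 hu hsq j k) _

theorem abs_inner_fderiv_le {C : NNReal}
    {F : EuclideanSpace ℝ (Fin D) → EuclideanSpace ℝ (Fin D)}
    (hF : LipschitzWith C F) (x v : EuclideanSpace ℝ (Fin D)) :
    |inner ℝ v (fderiv ℝ F x v)| ≤ C * ‖v‖ ^ 2 := by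
  calc |inner ℝ v (fderiv ℝ F x v)| ≤ ‖v‖ * ‖fderiv ℝ F x v‖ := abs_real_inner_le_norm _ _
    _ ≤ ‖v‖ * (C * ‖v‖) := by
      gcongr
      exact (fderiv ℝ F x).le_of_opNorm_le (norm_fderiv_le_of_lipschitz ℝ hF) v
    _ = _ := by ring

theorem integrable_inner_fderiv {μ : Measure (EuclideanSpace ℝ (Fin D))} (hu : Measurable u)
    (hsq : Integrable (fun x => ‖u x‖ ^ 2) μ) {C : NNReal}
    {F : EuclideanSpace ℝ (Fin D) → EuclideanSpace ℝ (Fin D)} (hF : LipschitzWith C F) :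
    Integrable (fun x => inner ℝ (u x) (fderiv ℝ F x (u x))) μ := by
  refine (hsq.const_mul (C : ℝ)).mono' ?_ (.of_forall fun x => abs_inner_fderiv_le hF x _)
  have h1 : Measurable fun x => fderiv ℝ F x (u x) :=
    isBoundedBilinearMap_apply.continuous.measurable.comp ((measurable_fderiv ℝ F).prodMk hu)
  exact (hu.inner h1).aestronglyMeasurable

/-- Second-order expansion of `‖z‖²` where `v = (1 + h Bᵀ) z`. -/
theorem abs_norm_sq_sub_norm_sq_add_le {E : Type*} [NormedAddCommGroup E]
    [InnerProductSpace ℝ E] [CompleteSpace E] (B : E →L[ℝ] E) {C h : ℝ} (hB : ‖B‖ ≤ C)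
    (hh : |h| * C ≤ 1 / 2) {v z : E} (hv : v = z + h • ContinuousLinearMap.adjoint B z) :
    |‖z‖ ^ 2 - ‖v‖ ^ 2 + 2 * h * inner ℝ v (B v)| ≤ 8 * C ^ 2 * h ^ 2 * ‖v‖ ^ 2 := by
  set w := ContinuousLinearMap.adjoint B z with hw
  have hC : 0 ≤ C := (norm_nonneg B).trans hB
  have hwz : ‖w‖ ≤ C * ‖z‖ := by
    refine (ContinuousLinearMap.adjoint B).le_of_opNorm_le ?_ z
    rwa [LinearIsometryEquiv.norm_map]
  -- Since |h|C ≤ 1/2, the perturbation of z is absorbed, so the error can be measured by the known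
  -- v.
  have hzv : ‖z‖ ≤ 2 * ‖v‖ := by
    have h1 : z = v - h • w := by rw [hv]; abel
    have h2 : ‖z‖ ≤ ‖v‖ + |h| * ‖w‖ := by
      calc ‖z‖ = ‖v - h • w‖ := by rw [← h1]
        _ ≤ ‖v‖ + ‖h • w‖ := norm_sub_le _ _
        _ = _ := by rw [norm_smul, Real.norm_eq_abs]
    have h3 : |h| * ‖w‖ ≤ 1 / 2 * ‖z‖ := by
      calc |h| * ‖w‖ ≤ |h| * (C * ‖z‖) := by gcongr
        _ = (|h| * C) * ‖z‖ := by ring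
        _ ≤ _ := by gcongr
    linarith
  have hBv : inner ℝ v (B v) = inner ℝ w v + h * inner ℝ w (B v) := by
    calc inner ℝ v (B v) = inner ℝ (z + h • w) (B v) := by rw [← hv]
      _ = _ := by
        rw [inner_add_left, real_inner_smul_left,
          ← ContinuousLinearMap.adjoint_inner_left B v z]
  have hvv : ‖v‖ ^ 2 = ‖z‖ ^ 2 + 2 * h * inner ℝ w z + h ^ 2 * ‖w‖ ^ 2 := by
    rw [hv, norm_add_sq_real, norm_smul, real_inner_smul_right, real_inner_comm, mul_pow,
      Real.norm_eq_abs, sq_abs]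
    ring
  have hwv : inner ℝ w v = inner ℝ w z + h * ‖w‖ ^ 2 := by
    rw [hv, inner_add_right, real_inner_smul_right, real_inner_self_eq_norm_sq]
  -- The first-order terms cancel exactly.
  have hexp : ‖z‖ ^ 2 - ‖v‖ ^ 2 + 2 * h * inner ℝ v (B v) =
      h ^ 2 * (‖w‖ ^ 2 + 2 * inner ℝ w (B v)) := by
    rw [hBv, hvv, hwv]; ring
  have hin : |inner ℝ w (B v)| ≤ 2 * C ^ 2 * ‖v‖ ^ 2 := by
    calc |inner ℝ w (B v)| ≤ ‖w‖ * ‖B v‖ := abs_real_inner_le_norm _ _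
      _ ≤ (C * (2 * ‖v‖)) * (C * ‖v‖) := by
        gcongr
        · exact hwz.trans (by gcongr)
        · exact B.le_of_opNorm_le hB v
      _ = _ := by ring
  have hw2 : ‖w‖ ^ 2 ≤ 4 * C ^ 2 * ‖v‖ ^ 2 := by
    calc ‖w‖ ^ 2 ≤ (C * (2 * ‖v‖)) ^ 2 := by
          gcongr
          exact hwz.trans (by gcongr)
      _ = _ := by ring
  rw [hexp, abs_mul, abs_of_nonneg (sq_nonneg h)]
  have h1 : |‖w‖ ^ 2 + 2 * inner ℝ w (B v)| ≤ 8 * C ^ 2 * ‖v‖ ^ 2 := by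
    rw [abs_le] at hin ⊢
    constructor <;> nlinarith [sq_nonneg ‖w‖]
  nlinarith [mul_le_mul_of_nonneg_left h1 (sq_nonneg h)]

end QuadraticForm

/-! ### Transport of density ratios and score differences -/

section Density

open Filter Topology

variable {D : ℕ} {f₀ f₁ g₀ g₁ : EuclideanSpace ℝ (Fin D) → ℝ}

theorem map_withDensity_comp {α β : Type*} [MeasurableSpace α] [MeasurableSpace β]
    {μ : Measure α} {ψ : α → β} (hψ : Measurable ψ) {G : β → ENNReal} (hG : Measurable G) :
    (μ.withDensity (G ∘ ψ)).map ψ = (μ.map ψ).withDensity G := by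
  ext s hs
  rw [Measure.map_apply hψ hs, withDensity_apply _ (hψ hs), withDensity_apply _ hs,
    setLIntegral_map hs hG hψ]
  rfl

theorem ae_densityMeasure_pos (hf : Measurable f₀) : ∀ᵐ x ∂(densityMeasure f₀), 0 < f₀ x := by
  rw [densityMeasure, ae_withDensity_iff hf.ennreal_ofReal]
  exact .of_forall fun x hx => by simpa using hx

/-- The ratio of two densities is transported by a common push-forward. -/
theorem density_mul_comp_eq (ψ : EuclideanSpace ℝ (Fin D) ≃ₜ EuclideanSpace ℝ (Fin D))
    (hf₀ : IsDiffProbDensity f₀) (hf₁ : IsDiffProbDensity f₁)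
    (hg₀ : IsDiffProbDensity g₀) (hg₁ : IsDiffProbDensity g₁)
    (hf : densityMeasure f₁ = (densityMeasure f₀).map ψ)
    (hg : densityMeasure g₁ = (densityMeasure g₀).map ψ) (x : EuclideanSpace ℝ (Fin D)) :
    f₀ x * g₁ (ψ x) = g₀ x * f₁ (ψ x) := by
  have hc : ∀ {f : EuclideanSpace ℝ (Fin D) → ℝ}, IsDiffProbDensity f →
      Continuous fun x => ENNReal.ofReal (f x) := fun h =>
    ENNReal.continuous_ofReal.comp h.differentiable.continuous
  have push : ∀ {a₀ a₁ b₀ : EuclideanSpace ℝ (Fin D) → ℝ}, IsDiffProbDensity a₀ →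
      IsDiffProbDensity a₁ → IsDiffProbDensity b₀ →
      densityMeasure a₁ = (densityMeasure a₀).map ψ →
      volume.withDensity (fun y => ENNReal.ofReal (a₁ y) * ENNReal.ofReal (b₀ (ψ.symm y))) =
        (volume.withDensity
          (fun y => ENNReal.ofReal (a₀ y) * ENNReal.ofReal (b₀ y))).map ψ := by
    intro a₀ a₁ b₀ h₀ h₁ hb h
    have hG : Measurable fun y => ENNReal.ofReal (b₀ (ψ.symm y)) :=
      ((hc hb).comp ψ.symm.continuous).measurable
    have e1 := withDensity_mul volume (hc h₁).measurable hG
    have e0 := withDensity_mul volume (hc h₀).measurable (hc hb).measurable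
    have e2 := map_withDensity_comp (μ := densityMeasure a₀) ψ.continuous.measurable hG
    have e3 : (fun y => ENNReal.ofReal (b₀ (ψ.symm y))) ∘ ψ = fun y => ENNReal.ofReal (b₀ y) := by
      ext y; simp
    rw [e3, ← h] at e2
    exact e1.trans (e2.symm.trans (congrArg (Measure.map ψ) e0.symm))
  -- Both weighted measures are the push-forward of the one with density f₀ g₀, so no Jacobian
  -- determinant has to be computed.
  have key := (push hf₀ hf₁ hg₀ hf).trans
    ((congrArg (fun F => (volume.withDensity F).map ψ)
      (funext fun y => mul_comm _ _)).trans (push hg₀ hg₁ hf₀ hg).symm)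
  have hcm : ∀ {a b : EuclideanSpace ℝ (Fin D) → ℝ}, IsDiffProbDensity a → IsDiffProbDensity b →
      Continuous fun y => a y * b (ψ.symm y) := fun ha hb =>
    ha.differentiable.continuous.mul (hb.differentiable.continuous.comp ψ.symm.continuous)
  simp only [← ENNReal.ofReal_mul (hf₁.nonneg _), ← ENNReal.ofReal_mul (hg₁.nonneg _)] at key
  rw [withDensity_eq_iff_of_sigmaFinite (hcm hf₁ hg₀).measurable.ennreal_ofReal.aemeasurable
    (hcm hg₁ hf₀).measurable.ennreal_ofReal.aemeasurable] at key
  have hae : (fun y => f₁ y * g₀ (ψ.symm y)) =ᵐ[volume] fun y => g₁ y * f₀ (ψ.symm y) :=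
    key.mono fun y hy => (ENNReal.ofReal_eq_ofReal_iff
      (mul_nonneg (hf₁.nonneg _) (hg₀.nonneg _)) (mul_nonneg (hg₁.nonneg _) (hf₀.nonneg _))).1 hy
  -- Continuity upgrades almost everywhere equality to equality at every point.
  have h := congrFun ((Continuous.ae_eq_iff_eq volume (hcm hf₁ hg₀) (hcm hg₁ hf₀)).1 hae) (ψ x)
  simp only [Homeomorph.symm_apply_apply] at h
  linarith

theorem hasFDerivAt_log_sub_log {x : EuclideanSpace ℝ (Fin D)} (hf : DifferentiableAt ℝ f₀ x)
    (hg : DifferentiableAt ℝ g₀ x) (hf0 : 0 < f₀ x) (hg0 : 0 < g₀ x) :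
    HasFDerivAt (fun y => Real.log (g₀ y) - Real.log (f₀ y))
      (innerSL ℝ (scoreDiff f₀ g₀ x)) x := by
  have h1 := ((hg.log hg0.ne').hasGradientAt.hasFDerivAt).sub
    ((hf.log hf0.ne').hasGradientAt.hasFDerivAt)
  rw [← map_sub] at h1
  exact h1

theorem eq_adjoint_fderiv_of_eventuallyEq_comp {ψ : EuclideanSpace ℝ (Fin D) → EuclideanSpace ℝ (Fin D)}
    {x : EuclideanSpace ℝ (Fin D)} (hψ : DifferentiableAt ℝ ψ x)
    {a b : EuclideanSpace ℝ (Fin D)} {u w : EuclideanSpace ℝ (Fin D) → ℝ}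
    (hu : HasFDerivAt u (innerSL ℝ a) x) (hw : HasFDerivAt w (innerSL ℝ b) (ψ x))
    (heq : u =ᶠ[𝓝 x] w ∘ ψ) : a = ContinuousLinearMap.adjoint (fderiv ℝ ψ x) b := by
  have huniq := hu.unique ((hw.comp x hψ.hasFDerivAt).congr_of_eventuallyEq heq)
  refine ext_inner_right ℝ fun v => ?_
  rw [ContinuousLinearMap.adjoint_inner_left]
  exact DFunLike.congr_fun huniq v

/-- Positivity must hold on a neighbourhood for the logarithm of the cross-multiplied identity to
split there; continuity supplies it. -/
theorem log_sub_log_eventuallyEq_comp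
    (ψ : EuclideanSpace ℝ (Fin D) ≃ₜ EuclideanSpace ℝ (Fin D)) (hf₀ : Continuous f₀)
    (hf₁ : Continuous f₁) (hg₀ : Continuous g₀) (hg₁ : Continuous g₁)
    (hmul : ∀ x, f₀ x * g₁ (ψ x) = g₀ x * f₁ (ψ x)) {x : EuclideanSpace ℝ (Fin D)}
    (hx1 : 0 < f₀ x) (hx2 : 0 < g₀ x) (hx3 : 0 < f₁ (ψ x)) (hx4 : 0 < g₁ (ψ x)) :
    (fun y => Real.log (g₀ y) - Real.log (f₀ y)) =ᶠ[𝓝 x]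
      (fun y => Real.log (g₁ y) - Real.log (f₁ y)) ∘ ψ := by
  filter_upwards [hf₀.continuousAt.eventually (lt_mem_nhds hx1),
    hg₀.continuousAt.eventually (lt_mem_nhds hx2),
    (hf₁.comp ψ.continuous).continuousAt.eventually (lt_mem_nhds hx3),
    (hg₁.comp ψ.continuous).continuousAt.eventually (lt_mem_nhds hx4)] with y y1 y2 y3 y4
  have h := congrArg Real.log (hmul y)
  simp only [Function.comp_apply] at y3 y4 ⊢
  rw [Real.log_mul y1.ne' y4.ne', Real.log_mul y2.ne' y3.ne'] at h
  linarith

/-- Chain rule: score differences are transported by the adjoint Jacobian. -/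
theorem scoreDiff_eq_adjoint_fderiv
    (ψ : EuclideanSpace ℝ (Fin D) ≃ₜ EuclideanSpace ℝ (Fin D))
    (hf₀ : IsDiffProbDensity f₀) (hf₁ : IsDiffProbDensity f₁)
    (hg₀ : IsDiffProbDensity g₀) (hg₁ : IsDiffProbDensity g₁)
    (hf : densityMeasure f₁ = (densityMeasure f₀).map ψ)
    (hg : densityMeasure g₁ = (densityMeasure g₀).map ψ)
    (hac : densityMeasure f₀ ≪ densityMeasure g₀) :
    ∀ᵐ x ∂(densityMeasure f₀), DifferentiableAt ℝ ψ x →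
      scoreDiff f₀ g₀ x =
        ContinuousLinearMap.adjoint (fderiv ℝ ψ x) (scoreDiff f₁ g₁ (ψ x)) := by
  have hm : ∀ {f : EuclideanSpace ℝ (Fin D) → ℝ}, IsDiffProbDensity f → Continuous f :=
    fun h => h.differentiable.continuous
  have hψm : AEMeasurable ψ (densityMeasure f₀) := ψ.continuous.measurable.aemeasurable
  have hac₁ : densityMeasure f₁ ≪ densityMeasure g₁ := by
    rw [hf, hg]
    exact hac.map ψ.continuous.measurable
  have p1 : ∀ᵐ x ∂(densityMeasure f₀), 0 < f₁ (ψ x) := by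
    refine ae_of_ae_map (p := fun y => 0 < f₁ y) hψm ?_
    rw [← hf]
    exact ae_densityMeasure_pos (hm hf₁).measurable
  have p2 : ∀ᵐ x ∂(densityMeasure f₀), 0 < g₁ (ψ x) := by
    refine ae_of_ae_map (p := fun y => 0 < g₁ y) hψm ?_
    rw [← hf]
    exact hac₁.ae_le (ae_densityMeasure_pos (hm hg₁).measurable)
  filter_upwards [ae_densityMeasure_pos (hm hf₀).measurable,
    hac.ae_le (ae_densityMeasure_pos (hm hg₀).measurable), p1, p2] with x hx1 hx2 hx3 hx4 hψ
  exact eq_adjoint_fderiv_of_eventuallyEq_comp hψ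
    (hasFDerivAt_log_sub_log (hf₀.differentiable x) (hg₀.differentiable x) hx1 hx2)
    (hasFDerivAt_log_sub_log (hf₁.differentiable (ψ x)) (hg₁.differentiable (ψ x)) hx3 hx4)
    (log_sub_log_eventuallyEq_comp ψ (hm hf₀) (hm hf₁) (hm hg₀) (hm hg₁)
      (density_mul_comp_eq ψ hf₀ hf₁ hg₀ hg₁ hf hg) hx1 hx2 hx3 hx4)

theorem measurable_scoreDiff (f g : EuclideanSpace ℝ (Fin D) → ℝ) :
    Measurable (scoreDiff f g) := by
  have h : ∀ f : EuclideanSpace ℝ (Fin D) → ℝ, Measurable (scoreFn f) := fun f =>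
    (InnerProductSpace.toDual ℝ (EuclideanSpace ℝ (Fin D))).symm.continuous.measurable.comp
      (measurable_fderiv ℝ _)
  exact (h g).sub (h f)

/-- The chain rule for the inverse map bounds the new score difference by L times the old one, so
finiteness propagates in time. -/
theorem integrable_norm_sq_scoreDiff_of_map
    (ψ : EuclideanSpace ℝ (Fin D) ≃ₜ EuclideanSpace ℝ (Fin D)) {L : NNReal}
    (hL : LipschitzWith L ψ.symm)
    (hf₀ : IsDiffProbDensity f₀) (hf₁ : IsDiffProbDensity f₁)
    (hg₀ : IsDiffProbDensity g₀) (hg₁ : IsDiffProbDensity g₁)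
    (hf : densityMeasure f₁ = (densityMeasure f₀).map ψ)
    (hg : densityMeasure g₁ = (densityMeasure g₀).map ψ)
    (hac : densityMeasure f₀ ≪ densityMeasure g₀)
    (hsq : Integrable (fun x => ‖scoreDiff f₀ g₀ x‖ ^ 2) (densityMeasure f₀)) :
    Integrable (fun x => ‖scoreDiff f₁ g₁ x‖ ^ 2) (densityMeasure f₁) := by
  have inv : ∀ {a b : EuclideanSpace ℝ (Fin D) → ℝ}, densityMeasure b = (densityMeasure a).map ψ →
      densityMeasure a = (densityMeasure b).map ψ.symm := by
    intro a b h
    rw [h, Measure.map_map ψ.symm.continuous.measurable ψ.continuous.measurable,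
      Homeomorph.symm_comp_self, Measure.map_id]
  have hac₁ : densityMeasure f₁ ≪ densityMeasure g₁ := by
    rw [hf, hg]
    exact hac.map ψ.continuous.measurable
  have hsq' : Integrable (fun x => ‖scoreDiff f₀ g₀ (ψ.symm x)‖ ^ 2) (densityMeasure f₁) := by
    rw [inv hf] at hsq
    exact hsq.comp_measurable ψ.symm.continuous.measurable
  refine (hsq'.const_mul ((L : ℝ) ^ 2)).mono'
    ((measurable_scoreDiff f₁ g₁).norm.pow_const 2).aestronglyMeasurable ?_
  filter_upwards [scoreDiff_eq_adjoint_fderiv ψ.symm hf₁ hf₀ hg₁ hg₀ (inv hf) (inv hg) hac₁,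
    (densityMeasure_absolutelyContinuous_volume f₁).ae_le hL.ae_differentiableAt] with x hx hd
  rw [hx hd, Real.norm_of_nonneg (by positivity), ← mul_pow]
  gcongr
  refine ContinuousLinearMap.le_of_opNorm_le _ ?_ _
  rw [LinearIsometryEquiv.norm_map]
  exact norm_fderiv_le_of_lipschitz ℝ hL

end Density

/-! ### Differentiating the Fisher divergence -/

theorem ae_abs_norm_sq_scoreDiff_sub_le {D : ℕ} {f₀ f₁ g₀ g₁ : EuclideanSpace ℝ (Fin D) → ℝ}
    (ψ : EuclideanSpace ℝ (Fin D) ≃ₜ EuclideanSpace ℝ (Fin D)) {h : ℝ} (h0 : h ≠ 0) {C : NNReal}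
    (hC : LipschitzWith C fun x => h⁻¹ • (ψ x - x)) (hh : |h| * C ≤ 1 / 2)
    (hf₀ : IsDiffProbDensity f₀) (hf₁ : IsDiffProbDensity f₁)
    (hg₀ : IsDiffProbDensity g₀) (hg₁ : IsDiffProbDensity g₁)
    (hf : densityMeasure f₁ = (densityMeasure f₀).map ψ)
    (hg : densityMeasure g₁ = (densityMeasure g₀).map ψ)
    (hac : densityMeasure f₀ ≪ densityMeasure g₀) :
    ∀ᵐ x ∂(densityMeasure f₀),
      |‖scoreDiff f₁ g₁ (ψ x)‖ ^ 2 - ‖scoreDiff f₀ g₀ x‖ ^ 2 + 2 * h *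
        inner ℝ (scoreDiff f₀ g₀ x)
          (fderiv ℝ (fun x => h⁻¹ • (ψ x - x)) x (scoreDiff f₀ g₀ x))| ≤
        8 * C ^ 2 * h ^ 2 * ‖scoreDiff f₀ g₀ x‖ ^ 2 := by
  filter_upwards [scoreDiff_eq_adjoint_fderiv ψ hf₀ hf₁ hg₀ hg₁ hf hg hac,
    (densityMeasure_absolutelyContinuous_volume f₀).ae_le hC.ae_differentiableAt] with x hx hd
  have hψ : ∀ y, ψ y = y + h • (h⁻¹ • (ψ y - y)) := fun y => by
    rw [smul_inv_smul₀ h0, add_sub_cancel]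
  have hder : HasFDerivAt ψ (ContinuousLinearMap.id ℝ (EuclideanSpace ℝ (Fin D)) +
      h • fderiv ℝ (fun x => h⁻¹ • (ψ x - x)) x) x :=
    ((hasFDerivAt_id x).add (hd.hasFDerivAt.const_smul h)).congr_of_eventuallyEq (.of_forall hψ)
  refine abs_norm_sq_sub_norm_sq_add_le _ (norm_fderiv_le_of_lipschitz ℝ hC) hh ?_
  -- The chain rule with Dψ = 1 + hB, B the Jacobian of the quotient, is the relation between v and
  -- z that the expansion requires.
  rw [hx hder.differentiableAt, hder.fderiv]
  refine ext_inner_right ℝ fun v => ?_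
  rw [ContinuousLinearMap.adjoint_inner_left, inner_add_left, real_inner_smul_left,
    ContinuousLinearMap.adjoint_inner_left, add_apply, inner_add_right, smul_apply,
    real_inner_smul_right, ContinuousLinearMap.id_apply]

/-- First-order expansion of the Fisher divergence under a near-identity transport. -/
theorem abs_fisherDivergence_sub_add_le {D : ℕ} {f₀ f₁ g₀ g₁ : EuclideanSpace ℝ (Fin D) → ℝ}
    (ψ : EuclideanSpace ℝ (Fin D) ≃ₜ EuclideanSpace ℝ (Fin D)) {h : ℝ} (h0 : h ≠ 0) {C : NNReal}
    (hC : LipschitzWith C fun x => h⁻¹ • (ψ x - x)) (hh : |h| * C ≤ 1 / 2)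
    (hf₀ : IsDiffProbDensity f₀) (hf₁ : IsDiffProbDensity f₁)
    (hg₀ : IsDiffProbDensity g₀) (hg₁ : IsDiffProbDensity g₁)
    (hf : densityMeasure f₁ = (densityMeasure f₀).map ψ)
    (hg : densityMeasure g₁ = (densityMeasure g₀).map ψ)
    (hac : densityMeasure f₀ ≪ densityMeasure g₀)
    (hi₀ : Integrable (fun x => ‖scoreDiff f₀ g₀ x‖ ^ 2) (densityMeasure f₀))
    (hi₁ : Integrable (fun x => ‖scoreDiff f₁ g₁ x‖ ^ 2) (densityMeasure f₁)) :
    |fisherDivergence f₁ g₁ - fisherDivergence f₀ g₀ + h *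
        ∫ x, inner ℝ (scoreDiff f₀ g₀ x)
          (fderiv ℝ (fun x => h⁻¹ • (ψ x - x)) x (scoreDiff f₀ g₀ x)) ∂(densityMeasure f₀)| ≤
      4 * C ^ 2 * h ^ 2 * ∫ x, ‖scoreDiff f₀ g₀ x‖ ^ 2 ∂(densityMeasure f₀) := by
  have hψm : Measurable ψ := ψ.continuous.measurable
  have hsm : Measurable fun x => ‖scoreDiff f₁ g₁ x‖ ^ 2 :=
    (measurable_scoreDiff _ _).norm.pow_const 2
  have hzi : Integrable (fun x => ‖scoreDiff f₁ g₁ (ψ x)‖ ^ 2) (densityMeasure f₀) := by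
    rw [hf] at hi₁
    exact hi₁.comp_measurable hψm
  have hF : fisherDivergence f₁ g₁ =
      (1 / 2) * ∫ x, ‖scoreDiff f₁ g₁ (ψ x)‖ ^ 2 ∂(densityMeasure f₀) := by
    rw [fisherDivergence, hf, integral_map hψm.aemeasurable hsm.aestronglyMeasurable]
  have hexp := ae_abs_norm_sq_scoreDiff_sub_le ψ h0 hC hh hf₀ hf₁ hg₀ hg₁ hf hg hac
  simp only [← Real.norm_eq_abs] at hexp
  have hI := norm_integral_le_of_norm_le (hi₀.const_mul (8 * C ^ 2 * h ^ 2)) hexp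
  have hsub : Integrable (fun x => ‖scoreDiff f₁ g₁ (ψ x)‖ ^ 2 - ‖scoreDiff f₀ g₀ x‖ ^ 2)
      (densityMeasure f₀) := hzi.sub hi₀
  rw [integral_const_mul, integral_add hsub
    ((integrable_inner_fderiv (measurable_scoreDiff _ _) hi₀ hC).const_mul _),
    integral_sub hzi hi₀, integral_const_mul, Real.norm_eq_abs] at hI
  rw [hF, fisherDivergence]
  generalize (∫ x, ‖scoreDiff f₁ g₁ (ψ x)‖ ^ 2 ∂(densityMeasure f₀)) = a at hI ⊢
  generalize (∫ x, ‖scoreDiff f₀ g₀ x‖ ^ 2 ∂(densityMeasure f₀)) = b at hI ⊢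
  generalize (∫ x, inner ℝ (scoreDiff f₀ g₀ x) (fderiv ℝ (fun x => h⁻¹ • (ψ x - x)) x
    (scoreDiff f₀ g₀ x)) ∂(densityMeasure f₀)) = c at hI ⊢
  rw [abs_le] at hI ⊢
  constructor <;> linarith [hI.1, hI.2]

open Filter Topology in
/-- If the time-`h` maps of a flow transport the densities `q t`, `p t` to `q (t + h)`,
`p (t + h)`, the Fisher divergence has the derivative given by the drift Jacobian. -/
theorem hasDerivWithinAt_fisherDivergence {D : ℕ}
    {g : EuclideanSpace ℝ (Fin D) → EuclideanSpace ℝ (Fin D)} {K : NNReal}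
    (hg : LipschitzWith K g)
    {φ : ℝ → EuclideanSpace ℝ (Fin D) → EuclideanSpace ℝ (Fin D)} (hφ : IsODEFlow g φ)
    {p q : ℝ → EuclideanSpace ℝ (Fin D) → ℝ} {S : Set ℝ} {t : ℝ} (ht : t ∈ S)
    (hp : ∀ s ∈ S, IsDiffProbDensity (p s)) (hq : ∀ s ∈ S, IsDiffProbDensity (q s))
    (hpt : ∀ s ∈ S, densityMeasure (p s) = (densityMeasure (p t)).map (φ (s - t)))
    (hqt : ∀ s ∈ S, densityMeasure (q s) = (densityMeasure (q t)).map (φ (s - t)))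
    (hac : densityMeasure (q t) ≪ densityMeasure (p t))
    (hsq : ∀ s ∈ S, Integrable (fun x => ‖scoreDiff (q s) (p s) x‖ ^ 2) (densityMeasure (q s))) :
    HasDerivWithinAt (fun s => fisherDivergence (q s) (p s))
      (-∫ x, inner ℝ (scoreDiff (q t) (p t) x) (fderiv ℝ g x (scoreDiff (q t) (p t) x))
        ∂(densityMeasure (q t))) S t := by
  set μ := densityMeasure (q t) with hμ
  set Δ := scoreDiff (q t) (p t) with hΔ
  -- The displacement constant for times |s - t| ≤ 1.
  set C : NNReal := (K * Real.exp (K * 1)).toNNReal with hC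
  set f : ℝ → EuclideanSpace ℝ (Fin D) → EuclideanSpace ℝ (Fin D) :=
    fun s x => (s - t)⁻¹ • (φ (s - t) x - x) with hf
  have hΔm : Measurable Δ := measurable_scoreDiff _ _
  have hΔi : Integrable (fun x => ‖Δ x‖ ^ 2) μ := hsq t ht
  have hne : Tendsto (fun s => s - t) (𝓝[S \ {t}] t) (𝓝[≠] 0) := by
    refine tendsto_nhdsWithin_iff.2 ⟨?_, ?_⟩
    · have h : Tendsto (fun s : ℝ => s - t) (𝓝 t) (𝓝 (t - t)) := by
        exact (continuous_id.sub continuous_const).tendsto t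
      rw [sub_self] at h
      exact h.mono_left nhdsWithin_le_nhds
    · filter_upwards [self_mem_nhdsWithin] with s hs
      exact sub_ne_zero.2 hs.2
  have habs : Tendsto (fun s => |s - t|) (𝓝[S \ {t}] t) (𝓝 0) := by
    simpa using (hne.mono_right nhdsWithin_le_nhds).abs
  have hsmall : ∀ᶠ s in 𝓝[S \ {t}] t, |s - t| ≤ 1 ∧ |s - t| * C ≤ 1 / 2 := by
    have h2 : Tendsto (fun s => |s - t| * C) (𝓝[S \ {t}] t) (𝓝 0) := by
      simpa using habs.mul_const (C : ℝ)
    exact (habs.eventually (ge_mem_nhds one_pos)).and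
      (h2.eventually (ge_mem_nhds (by norm_num)))
  have hfL : ∀ᶠ s in 𝓝[S \ {t}] t, LipschitzWith C (f s) :=
    hsmall.mono fun s hs => hφ.lipschitzWith_displacement hg hs.1
  -- The weak-* lemma wants one Lipschitz constant for the quotients and their limit g.
  have hKC : K ≤ C := NNReal.le_toNNReal_of_coe_le
    (le_mul_of_one_le_right K.2 (Real.one_le_exp (by positivity)))
  have hlim := tendsto_integral_inner_fderiv (hq t ht).differentiable.continuous.measurable
    (hq t ht).nonneg hΔm hΔi hfL (hg.weaken hKC) fun x => (hφ.tendsto_displacement x).comp hne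
  rw [hasDerivWithinAt_iff_tendsto_slope]
  -- Dividing the expansion by |s - t| leaves an error of order |s - t|.
  have hbound : ∀ᶠ s in 𝓝[S \ {t}] t,
      dist (slope (fun s => fisherDivergence (q s) (p s)) t s)
        (-∫ x, inner ℝ (Δ x) (fderiv ℝ (f s) x (Δ x)) ∂μ) ≤
      |s - t| * (4 * C ^ 2 * ∫ x, ‖Δ x‖ ^ 2 ∂μ) := by
    filter_upwards [hsmall, self_mem_nhdsWithin] with s hs hsS
    have hfs : LipschitzWith C (f s) := hφ.lipschitzWith_displacement hg hs.1
    have key := abs_fisherDivergence_sub_add_le (hφ.homeomorph hg (s - t)) (sub_ne_zero.2 hsS.2)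
      hfs hs.2 (hq t ht) (hq s hsS.1) (hp t ht) (hp s hsS.1) (hqt s hsS.1) (hpt s hsS.1) hac
      (hsq t ht) (hsq s hsS.1)
    have hpos : 0 < |s - t| := abs_pos.2 (sub_ne_zero.2 hsS.2)
    have h0 : s - t ≠ 0 := sub_ne_zero.2 hsS.2
    rw [slope_def_field, Real.dist_eq, sub_neg_eq_add, ← mul_le_mul_iff_right₀ hpos, ← abs_mul,
      mul_add, mul_div_cancel₀ _ h0]
    refine key.trans (le_of_eq ?_)
    rw [← sq_abs (s - t)]
    ring
  have hzero : Tendsto (fun s => |s - t| * (4 * C ^ 2 * ∫ x, ‖Δ x‖ ^ 2 ∂μ))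
      (𝓝[S \ {t}] t) (𝓝 0) := by
    simpa using habs.mul_const (4 * (C : ℝ) ^ 2 * ∫ x, ‖Δ x‖ ^ 2 ∂μ)
  have hd0 := squeeze_zero' (.of_forall fun _ => dist_nonneg) hbound hzero
  exact (tendsto_iff_of_dist hd0).2 hlim.neg

theorem driftQuadForm_eq {D : ℕ} (g : EuclideanSpace ℝ (Fin D) → EuclideanSpace ℝ (Fin D))
    (q p : EuclideanSpace ℝ (Fin D) → ℝ) (x : EuclideanSpace ℝ (Fin D)) :
    driftQuadForm g q p x =
      2 * inner ℝ (scoreDiff q p x) (fderiv ℝ g x (scoreDiff q p x)) := by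
  rw [driftQuadForm, add_apply, inner_add_right,
    ContinuousLinearMap.adjoint_inner_right, real_inner_comm (scoreDiff q p x)]
  ring

theorem proposition2 {D : ℕ}
    (g : EuclideanSpace ℝ (Fin D) → EuclideanSpace ℝ (Fin D))
    (K : NNReal) (hg : LipschitzWith K g)
    (φ : ℝ → EuclideanSpace ℝ (Fin D) → EuclideanSpace ℝ (Fin D)) (hφ : IsODEFlow g φ)
    (T : ℝ) (hT : 0 < T)
    (p q : ℝ → EuclideanSpace ℝ (Fin D) → ℝ)
    (hp : ∀ t ∈ Set.Icc 0 T, IsDiffProbDensity (p t))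
    (hq : ∀ t ∈ Set.Icc 0 T, IsDiffProbDensity (q t))
    -- `p t` and `q t` are the densities of `x(t)` when `x(0)` has density `p 0`, resp. `q 0`
    (hpt : ∀ t ∈ Set.Icc 0 T,
      densityMeasure (p t) = MeasureTheory.Measure.map (φ t) (densityMeasure (p 0)))
    (hqt : ∀ t ∈ Set.Icc 0 T,
      densityMeasure (q t) = MeasureTheory.Measure.map (φ t) (densityMeasure (q 0)))
    -- `F(q₀, p₀)` makes sense: `p₀ > 0` holds `q₀`-almost everywhere, and the value is finite
    (hac : (densityMeasure (q 0)).AbsolutelyContinuous (densityMeasure (p 0)))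
    (hfin : MeasureTheory.Integrable (fun x => ‖scoreDiff (q 0) (p 0) x‖ ^ 2)
      (densityMeasure (q 0))) :
    ∀ t ∈ Set.Icc 0 T,
      MeasureTheory.Integrable (fun x => ‖scoreDiff (q t) (p t) x‖ ^ 2) (densityMeasure (q t)) ∧
      MeasureTheory.Integrable (driftQuadForm g (q t) (p t)) (densityMeasure (q t)) ∧
      HasDerivWithinAt (fun s => fisherDivergence (q s) (p s))
        (-(1 / 2) * ∫ x, driftQuadForm g (q t) (p t) x ∂(densityMeasure (q t)))
        (Set.Icc 0 T) t := by
  have h0T : (0 : ℝ) ∈ Icc 0 T := ⟨le_rfl, hT.le⟩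
  have hm : ∀ t, Measurable (φ t) := fun t => (hφ.lipschitzWith hg t).continuous.measurable
  have hsq : ∀ t ∈ Icc 0 T,
      Integrable (fun x => ‖scoreDiff (q t) (p t) x‖ ^ 2) (densityMeasure (q t)) :=
    fun t ht => integrable_norm_sq_scoreDiff_of_map (hφ.homeomorph hg t)
      (hφ.lipschitzWith hg (-t)) (hq 0 h0T) (hq t ht) (hp 0 h0T) (hp t ht) (hqt t ht) (hpt t ht)
      hac hfin
  have hstep : ∀ {r : ℝ → EuclideanSpace ℝ (Fin D) → ℝ},
      (∀ t ∈ Icc 0 T, densityMeasure (r t) = (densityMeasure (r 0)).map (φ t)) →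
      ∀ t ∈ Icc 0 T, ∀ s ∈ Icc 0 T,
        densityMeasure (r s) = (densityMeasure (r t)).map (φ (s - t)) := by
    -- The group law allows any t to serve as the initial time, including for s < t.
    intro r hr t ht s hs
    rw [hr s hs, hr t ht, Measure.map_map (hm _) (hm _)]
    congr 1
    ext1 x
    rw [Function.comp_apply, ← hφ.add_apply hg, sub_add_cancel]
  intro t ht
  have hquad : driftQuadForm g (q t) (p t) = fun x =>
      2 * inner ℝ (scoreDiff (q t) (p t) x) (fderiv ℝ g x (scoreDiff (q t) (p t) x)) :=
    funext (driftQuadForm_eq g (q t) (p t))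
  refine ⟨hsq t ht, ?_, ?_⟩
  · rw [hquad]
    exact (integrable_inner_fderiv (measurable_scoreDiff _ _) (hsq t ht) hg).const_mul 2
  · have hac_t : densityMeasure (q t) ≪ densityMeasure (p t) := by
      rw [hqt t ht, hpt t ht]
      exact hac.map (hm t)
    have h := hasDerivWithinAt_fisherDivergence hg hφ ht hp hq (hstep hpt t ht) (hstep hqt t ht)
      hac_t hsq
    rw [hquad, integral_const_mul]
    convert h using 1
    ring
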